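/- Let $C[0,1]$ be the space of continuous real functions on $[0,1]$ with the norm $\|u\|_\infty=\max_{t\in[0,1]}|u(t)|$, let $\rho>0$ and $\overline B_\rho=\{u\in C[0,1]:\|u\|_\infty\le\rho\}$. Assume the following. (1) $k:[0,1]^2\to[0,\infty)$ is continuous. (2) $H:\overline B_\rho\to\mathbb R$ is continuous, and $\underline H,\overline H\in\mathbb R$ satisfy $\underline H\le H[u]\le\overline H$ for every $u\in\overline B_\rho$. (3) $f:\Pi_\rho:=[0,1]\times[-\rho,\rho]\times[\underline H,\overline H]\to\mathbb R$ is continuous. (4) $\underline f,\overline f:[0,1]\to\mathbb R$ are continuous, and $\underline f(t)\le f(t,x,v)\le\overline f(t)$ for every $(t,x,v)\in\Pi_\rho$. (5) With $\underline F(t):=\int_0^1k(t,s)\underline f(s)\,ds$ and $\overline F(t):=\int_0^1k(t,s)\overline f(s)\,ds$, at least one of the following holds: (5a) there is $t_\rho\in[0,1]$ with $\overline F(t_\rho)<0$; (5b) there is $t_\rho\in[0,1]$ with $\underline F(t_\rho)>0$. Then there exist $\lambda^+>0$, $\lambda^-<0$ and $u^+,u^-\in C[0,1]$ with $\|u^+\|_\infty=\|u^-\|_\infty=\rho$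 such that $(\lambda,u)=(\lambda^+,u^+)$ and $(\lambda,u)=(\lambda^-,u^-)$ both satisfy $$u(t)=\lambda\int_0^1k(t,s)\,f(s,u(s),H[u])\,ds\qquad\text{for all }t\in[0,1].$$ Furthermore, let $\lambda\in\mathbb R$ and $u\in C[0,1]$ with $\|u\|_\infty=\rho$ satisfy this equation. If $t_\rho\in[0,1]$ is any point with $\overline F(t_\rho)<0$, then $|\lambda|\le-\rho/\overline F(t_\rho)$; if $t_\rho\in[0,1]$ is any point with $\underline F(t_\rho)>0$, then $|\lambda|\le\rho/\underline F(t_\rho)$. -/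

import Mathlib

open Set MeasureTheory

open scoped unitInterval

/-- The linear Hammerstein-type integral `t ↦ ∫₀¹ k(t,s) g(s) ds`
(the measure on `I = [0,1]` is the Lebesgue measure). -/
noncomputable def kernelIntegral (k : I × I → ℝ) (g : I → ℝ) (t : I) : ℝ :=
  ∫ s : I, k (t, s) * g s

/-- `(l, u)` solves the functional Hammerstein integral equation
`u(t) = l ∫₀¹ k(t,s) f(s, u(s), H[u]) ds` for all `t ∈ [0,1]`.
Only the values of `H` at `u` and of `f` at the points `(s, u(s), H[u])` are used. -/
def SolvesHammerstein (k : I × I → ℝ) (f : I × ℝ × ℝ → ℝ) (H : C(I, ℝ) → ℝ)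
    (l : ℝ) (u : C(I, ℝ)) : Prop :=
  ∀ t : I, u t = l * ∫ s : I, k (t, s) * f (s, u s, H u)

/-!
The integral equation reads `u = λ T u`, where `T u = ∫ k(·, s) f(s, u(s), H[u]) ds` is a continuous
compact map on the closed ball of radius `ρ` in `C([0,1])`: it is the composition of a superposition
operator, which is continuous and bounded, with the compact integral operator `kernelOperator`.
Since `k ≥ 0`, the values `T u t` lie between the two kernel integrals of the bounds on `f`; the
sign condition at one point therefore keeps `‖T u‖` away from zero on the whole ball. Consequently
`u ↦ ± (ρ / ‖T u‖) T u` are continuous compact maps of the ball into its bounding sphere, and their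
fixed points, provided by Schauder's theorem, are solutions with `λ = ± ρ / ‖T u‖`
(`exists_pos_smul_eq_of_norm_ge`). The bounds on `|λ|` follow from `|λ| |T u t| = |u t| ≤ ρ`.

Schauder's theorem is reduced to Brouwer's by finite nets. Brouwer's theorem is proved by the
analytic method of Milnor and Rogers: a smooth map without fixed points would give a `C¹` retraction
`r` of a ball onto its bounding sphere (`exists_fixedPoint_of_contDiff`), and with `g = r - id` the
polynomial `t ↦ ∫ det (1 + t g')` is equal to the volume of the ball for small `t > 0` but vanishes
at `t = 1` (`not_exists_contDiff_retraction`).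
-/

/-! ### Determinants of perturbations of the identity -/

/-- `t ↦ det (1 + t A)` is a polynomial of degree at most `dim E`, so its value at `1` is given by
Lagrange interpolation at any `dim E + 1` distinct nodes, with weights that do not depend on `A`.
With small nodes this turns information about small perturbations of the identity into information
about `1 + A`. -/
theorem exists_det_one_add_interpolation {E : Type*} [NormedAddCommGroup E] [NormedSpace ℝ E]
    [FiniteDimensional ℝ E] (v : Fin (Module.finrank ℝ E + 1) → ℝ) (hv : Function.Injective v) :
    ∃ c : Fin (Module.finrank ℝ E + 1) → ℝ, ∑ j, c j = 1 ∧
      ∀ A : E →L[ℝ] E, (1 + A).det = ∑ j, c j * (1 + v j • A).det := by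
  refine ⟨fun j => (Lagrange.basis Finset.univ v j).eval 1, ?_, fun A => ?_⟩
  · rw [← Polynomial.eval_finsetSum, Lagrange.sum_basis hv.injOn Finset.univ_nonempty,
      Polynomial.eval_one]
  · let b := Module.finBasis ℝ E
    let M := LinearMap.toMatrix b b (A : E →ₗ[ℝ] E)
    let P : Polynomial ℝ := Matrix.det ((Polynomial.X : Polynomial ℝ) • M.map Polynomial.C
      + (1 : Matrix _ _ ℝ).map Polynomial.C)
    have hP : ∀ t : ℝ, P.eval t = (1 + t • A).det := by
      intro t
      have h1 : (1 + t • A).det = LinearMap.det ((1 + t • A : E →L[ℝ] E) : E →ₗ[ℝ] E) := rfl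
      rw [h1, ← LinearMap.det_toMatrix b, ← Polynomial.coe_evalRingHom, RingHom.map_det]
      congr 1
      have h2 : ((1 + t • A : E →L[ℝ] E) : E →ₗ[ℝ] E)
          = LinearMap.id + t • (A : E →ₗ[ℝ] E) := rfl
      rw [h2, map_add (LinearMap.toMatrix b b), map_smul, LinearMap.toMatrix_id]
      ext i j
      simp [M, Matrix.one_apply, add_comm, mul_comm t, apply_ite]
    have hdeg : P.degree < (Finset.univ : Finset (Fin (Module.finrank ℝ E + 1))).card := by
      refine lt_of_le_of_lt Polynomial.degree_le_natDegree ?_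
      have := Polynomial.natDegree_det_X_add_C_le M (1 : Matrix _ _ ℝ)
      simp only [Fintype.card_fin, Finset.card_univ] at this ⊢
      exact_mod_cast Nat.lt_succ_of_le this
    have h := congrArg (Polynomial.eval 1) (Lagrange.eq_interpolate hv.injOn hdeg)
    rw [hP, one_smul, Lagrange.interpolate_apply, Polynomial.eval_finsetSum] at h
    rw [h]
    refine Finset.sum_congr rfl fun j _ => ?_
    rw [Polynomial.eval_mul, Polynomial.eval_C, hP, mul_comm]

/-! ### Perturbations of the identity supported in a ball -/

/-- A Lipschitz map on a closed ball that vanishes on the bounding sphere, extended by zero, is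
Lipschitz with the same constant: a segment leaving the ball crosses the sphere. -/
theorem lipschitzWith_indicator_closedBall {E : Type*} [NormedAddCommGroup E] [NormedSpace ℝ E]
    {g : E → E} {R : ℝ} {L : NNReal} (hg : LipschitzOnWith L g (Metric.closedBall 0 R))
    (h0 : ∀ x, ‖x‖ = R → g x = 0) :
    LipschitzWith L ((Metric.closedBall 0 R).indicator g) := by
  have key : ∀ x ∈ Metric.closedBall (0 : E) R, ∀ y ∉ Metric.closedBall (0 : E) R,
      ‖g x‖ ≤ L * ‖x - y‖ := by
    intro x hx y hy
    rw [mem_closedBall_zero_iff] at hx hy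
    have hc : ContinuousOn (fun t : ℝ => ‖AffineMap.lineMap x y t‖) (Icc 0 1) := by
      simp only [AffineMap.lineMap_apply_module]
      fun_prop
    obtain ⟨t, ht, htR⟩ := intermediate_value_Icc zero_le_one hc
      (show R ∈ Icc _ _ by simpa using ⟨hx, (not_le.1 hy).le⟩)
    simp only at htR
    have h1 := hg.norm_sub_le (mem_closedBall_zero_iff.2 hx)
      (mem_closedBall_zero_iff.2 htR.le)
    rw [h0 _ htR, sub_zero] at h1
    refine h1.trans (mul_le_mul_of_nonneg_left ?_ L.2)
    rw [← dist_eq_norm, ← dist_eq_norm, dist_left_lineMap, Real.norm_of_nonneg ht.1]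
    exact mul_le_of_le_one_left dist_nonneg ht.2
  refine LipschitzWith.of_dist_le_mul fun x y => ?_
  rw [dist_eq_norm, dist_eq_norm]
  by_cases hx : x ∈ Metric.closedBall (0 : E) R <;> by_cases hy : y ∈ Metric.closedBall (0 : E) R
  · rw [indicator_of_mem hx, indicator_of_mem hy]
    exact hg.norm_sub_le hx hy
  · rw [indicator_of_mem hx, indicator_of_notMem hy, sub_zero]
    exact key x hx y hy
  · rw [indicator_of_notMem hx, indicator_of_mem hy, zero_sub, norm_neg, norm_sub_rev]
    exact key y hy x hx
  · rw [indicator_of_notMem hx, indicator_of_notMem hy, sub_zero, norm_zero]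
    positivity

/-- Solving `x + g x = y` amounts to finding the fixed point of the contraction `z ↦ y - g z`. -/
theorem bijective_id_add_of_lipschitzWith {E : Type*} [NormedAddCommGroup E] [CompleteSpace E]
    {g : E → E} {L : NNReal} (hL : L < 1) (hg : LipschitzWith L g) :
    Function.Bijective fun x => x + g x := by
  constructor
  · intro x y hxy
    have h1 : x - y = g y - g x := by
      simp only at hxy
      rw [sub_eq_sub_iff_add_eq_add, hxy, add_comm]
    have h2 := hg.norm_sub_le y x
    rw [← h1, norm_sub_rev y x] at h2
    have h3 : (L : ℝ) < 1 := hL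
    have : ‖x - y‖ = 0 := by nlinarith [norm_nonneg (x - y)]
    exact sub_eq_zero.1 (norm_eq_zero.1 this)
  · intro y
    have hc : ContractingWith L fun z => y - g z :=
      ⟨hL, LipschitzWith.of_dist_le_mul fun a b => by
        rw [dist_sub_left]; exact hg.dist_le_mul a b⟩
    refine ⟨hc.fixedPoint, ?_⟩
    have h : y - g (hc.fixedPoint _) = hc.fixedPoint _ := hc.fixedPoint_isFixedPt
    exact (sub_eq_iff_eq_add.1 h).symm

/-- A small perturbation of the identity that fixes the bounding sphere permutes the closed ball:
extended by the identity it is a bijection of the whole space which fixes every outside point. -/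
theorem bijOn_closedBall_id_add {E : Type*} [NormedAddCommGroup E] [NormedSpace ℝ E]
    [CompleteSpace E] {g : E → E} {R : ℝ} {L : NNReal} (hL : L < 1)
    (hg : LipschitzOnWith L g (Metric.closedBall 0 R)) (h0 : ∀ x, ‖x‖ = R → g x = 0) :
    BijOn (fun x => x + g x) (Metric.closedBall 0 R) (Metric.closedBall 0 R) := by
  have hbij := bijective_id_add_of_lipschitzWith hL (lipschitzWith_indicator_closedBall hg h0)
  set G := (Metric.closedBall (0 : E) R).indicator g with hG
  have hout : ∀ x ∉ Metric.closedBall (0 : E) R, x + G x = x := fun x hx => by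
    rw [hG, indicator_of_notMem hx, add_zero]
  have hin : EqOn (fun x => x + G x) (fun x => x + g x) (Metric.closedBall 0 R) := fun x hx => by
    simp only [hG, indicator_of_mem hx]
  refine BijOn.congr ⟨fun x hx => ?_, hbij.1.injOn, fun y hy => ?_⟩ hin
  -- If `F x = x + G x` were outside the ball it would be fixed by `F`, so `F x = x`
  -- by injectivity.
  · by_contra hx'
    have e : x + G x = x := hbij.1 (hout _ hx')
    exact hx' (show x + G x ∈ _ by rwa [e])
  · obtain ⟨x, rfl⟩ := hbij.2 y
    refine ⟨x, ?_, rfl⟩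
    by_contra hx
    simp only [hout x hx] at hy
    exact hx hy

/-! ### Brouwer's fixed point theorem -/

section Brouwer

variable {E : Type*} [NormedAddCommGroup E] [InnerProductSpace ℝ E] [FiniteDimensional ℝ E]

/-- For small `t` the map `x ↦ x + t g x` permutes the ball, so by change of variables the integral
of its Jacobian determinant is the volume of the ball. -/
theorem integral_det_eq_of_small [MeasurableSpace E] [BorelSpace E] {g : E → E}
    (hg : ContDiff ℝ 1 g) {R : ℝ} (h0 : ∀ x, ‖x‖ = R → g x = 0) :
    ∃ δ > 0, ∀ t : ℝ, 0 < t → t < δ →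
      ∫ x in Metric.closedBall 0 R, (1 + t • fderiv ℝ g x).det
        = volume.real (Metric.closedBall (0 : E) R) := by
  have hcont : Continuous (fderiv ℝ g) := hg.continuous_fderiv one_ne_zero
  obtain ⟨C, hC⟩ := (isCompact_closedBall (0 : E) R).exists_bound_of_continuousOn
    hcont.continuousOn
  obtain ⟨ε, hε, hdet⟩ : ∃ ε > 0, ∀ B : E →L[ℝ] E, ‖B‖ < ε → 0 < (1 + B).det := by
    have h : Filter.Tendsto (fun B : E →L[ℝ] E => (1 + B).det) (nhds 0) (nhds 1) := by
      have := (ContinuousLinearMap.continuous_det (E := E) (𝕜 := ℝ)).comp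
        (continuous_const_add (1 : E →L[ℝ] E))
      have h2 := this.tendsto 0
      simp only [Function.comp_apply, add_zero] at h2
      have h3 : (1 : E →L[ℝ] E).det = 1 := LinearMap.det_id
      rwa [h3] at h2
    obtain ⟨ε, hε, h⟩ := Metric.eventually_nhds_iff.1 (h.eventually (lt_mem_nhds one_pos))
    exact ⟨ε, hε, fun B hB => h (by simpa using hB)⟩
  -- `K` is a positive bound for `‖g'‖` on the ball, even when the ball is empty.
  set K := max C 0 + 1 with hK
  have hKpos : 0 < K := by positivity
  have hbd : ∀ x ∈ Metric.closedBall (0 : E) R, ‖fderiv ℝ g x‖ ≤ K := fun x hx =>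
    (hC x hx).trans ((le_max_left _ _).trans (by linarith))
  refine ⟨min (1 / K) (ε / K), by positivity, fun t ht0 ht => ?_⟩
  have ht1 : t * K < 1 := (lt_div_iff₀ hKpos).1 (ht.trans_le (min_le_left _ _))
  have ht2 : t * K < ε := (lt_div_iff₀ hKpos).1 (ht.trans_le (min_le_right _ _))
  have hdiff : ∀ x, HasFDerivAt g (fderiv ℝ g x) x := fun x =>
    (hg.differentiable one_ne_zero x).hasFDerivAt
  have hlip : LipschitzOnWith (t * K).toNNReal (fun x => t • g x)
      (Metric.closedBall 0 R) := by
    refine LipschitzOnWith.of_dist_le_mul fun x hx y hy => ?_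
    have := (convex_closedBall (0 : E) R).norm_image_sub_le_of_norm_fderiv_le
      (fun z _ => (hdiff z).differentiableAt) hbd hy hx
    rw [dist_eq_norm, dist_eq_norm, ← smul_sub, norm_smul, Real.norm_of_nonneg ht0.le,
      Real.coe_toNNReal _ (by positivity), mul_assoc]
    gcongr
  have hbij := bijOn_closedBall_id_add (Real.toNNReal_lt_one.2 ht1) hlip
    (fun x hx => by rw [h0 x hx, smul_zero])
  have hcov := integral_image_eq_integral_abs_det_fderiv_smul volume
    (Metric.isClosed_closedBall.measurableSet)
    (fun x _ => ((hasFDerivAt_id x).add ((hdiff x).const_smul t)).hasFDerivWithinAt)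
    hbij.injOn (fun _ => (1 : ℝ))
  have himg := hbij.image_eq
  change (id + t • g) '' _ = _ at himg
  rw [himg] at hcov
  simp only [integral_const, smul_eq_mul, mul_one, measureReal_restrict_apply_univ] at hcov
  rw [hcov]
  refine setIntegral_congr_fun Metric.isClosed_closedBall.measurableSet fun x hx => ?_
  refine (abs_of_pos (hdet _ ?_)).symm
  rw [norm_smul, Real.norm_of_nonneg ht0.le]
  exact (mul_le_mul_of_nonneg_left (hbd x hx) ht0.le).trans_lt ht2

/-- There is no `C¹` retraction onto a sphere. For `g = r - id`, the integral of `det (1 + t g')` over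
the ball is a polynomial in `t` that equals the volume of the ball for small `t`, hence also at
`t = 1`; but `det r' = 0` everywhere because `r` takes its values in a sphere. -/
theorem not_exists_contDiff_retraction {r : E → E} (hr : ContDiff ℝ 1 r) {R : ℝ} (hR : 0 < R)
    (hid : ∀ x, ‖x‖ = R → r x = x) (hnorm : ∀ x, ‖r x‖ = R) : False := by
  borelize E
  set g : E → E := fun x => r x - x with hg
  have hgd : ContDiff ℝ 1 g := hr.sub contDiff_id
  have h0 : ∀ x, ‖x‖ = R → g x = 0 := fun x hx => sub_eq_zero.2 (hid x hx)
  have hfd : ∀ x, 1 + fderiv ℝ g x = fderiv ℝ r x := fun x => by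
    rw [hg, fderiv_fun_sub (hr.differentiable one_ne_zero x) differentiableAt_fun_id, fderiv_fun_id]
    exact add_sub_cancel _ _
  have hdet0 : ∀ x, (1 + fderiv ℝ g x).det = 0 := by
    intro x
    rw [hfd]
    -- A nonzero determinant would give `y` with `r'(x) y = r(x)`; differentiating the constant
    -- `‖r‖²` in the direction `y` then yields `‖r x‖² = 0`.
    by_contra hne
    have hsurj : Function.Surjective (fderiv ℝ r x) :=
      (LinearMap.equivOfDetNeZero (fderiv ℝ r x : E →ₗ[ℝ] E) hne).surjective
    obtain ⟨y, hy⟩ := hsurj (r x)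
    have hd := (hr.differentiable one_ne_zero x).hasFDerivAt
    have h1 := hd.norm_sq
    have h2 : HasFDerivAt (fun z => ‖r z‖ ^ 2) (0 : E →L[ℝ] ℝ) x := by
      simp only [hnorm]
      exact hasFDerivAt_const _ _
    have h3 := congrArg (fun φ : E →L[ℝ] ℝ => φ y) (h1.unique h2)
    simp [hy, hnorm] at h3
    exact hR.ne' h3
  obtain ⟨δ, hδ, hint⟩ := integral_det_eq_of_small hgd h0
  -- Any distinct nodes in `(0, δ)` will do.
  let v : Fin (Module.finrank ℝ E + 1) → ℝ := fun j => δ / ((j : ℕ) + 2)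
  have hvinj : Function.Injective v := fun i j hij => by
    simp only [v] at hij
    rw [div_eq_div_iff (by positivity) (by positivity)] at hij
    have := mul_left_cancel₀ hδ.ne' hij
    exact Fin.ext (by exact_mod_cast (add_right_cancel this).symm)
  have hv0 : ∀ j, 0 < v j := fun j => by positivity
  have hvδ : ∀ j, v j < δ := fun j => by
    simp only [v]
    exact div_lt_self hδ (by have : (0 : ℝ) ≤ ((j : ℕ) : ℝ) := by positivity
                             linarith)
  obtain ⟨c, hc1, hc⟩ := exists_det_one_add_interpolation v hvinj
  have hcontd : ∀ j, IntegrableOn (fun x => c j * (1 + v j • fderiv ℝ g x).det)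
      (Metric.closedBall 0 R) := fun j => by
    have := hgd.continuous_fderiv one_ne_zero
    exact (continuous_const.mul (ContinuousLinearMap.continuous_det.comp
      (by fun_prop))).continuousOn.integrableOn_compact (isCompact_closedBall _ _)
  have : volume.real (Metric.closedBall (0 : E) R) = 0 := by
    calc volume.real (Metric.closedBall (0 : E) R)
        = ∑ j, c j * volume.real (Metric.closedBall (0 : E) R) := by
          rw [← Finset.sum_mul, hc1, one_mul]
      _ = ∑ j, ∫ x in Metric.closedBall 0 R, c j * (1 + v j • fderiv ℝ g x).det := by
          refine Finset.sum_congr rfl fun j _ => ?_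
          rw [integral_const_mul, hint _ (hv0 j) (hvδ j)]
      _ = ∫ x in Metric.closedBall 0 R, ∑ j, c j * (1 + v j • fderiv ℝ g x).det :=
          (integral_finsetSum _ fun j _ => hcontd j).symm
      _ = 0 := by simp only [← hc, hdet0, integral_zero]
  rw [measureReal_def, ENNReal.toReal_eq_zero_iff] at this
  rcases this with h | h
  · exact (Metric.measure_closedBall_pos volume (0 : E) hR).ne' h
  · exact measure_closedBall_lt_top.ne h

/-- Brouwer's theorem for `C¹` maps. The values of `q` are bounded on the whole space, which allows
the retraction to be built without solving a quadratic equation: if `q` has no fixed point, then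
`h x = x - χ x • q x`, with `χ` a cutoff function equal to `1` on the unit ball, has no zero and is
the identity outside the ball of radius `2`, so `2 h / ‖h‖` is a retraction onto the sphere of
radius `2`. -/
theorem exists_fixedPoint_of_contDiff {q : E → E} (hq : ContDiff ℝ 1 q) (hb : ∀ x, ‖q x‖ ≤ 1) :
    ∃ x, q x = x := by
  by_contra! hne
  let χ : ContDiffBump (0 : E) := ⟨1, 2, one_pos, one_lt_two⟩
  set h : E → E := fun x => x - χ x • q x with hh
  have hχ : ContDiff ℝ 1 χ := χ.contDiff
  have hhd : ContDiff ℝ 1 h := contDiff_id.sub (hχ.smul hq)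
  have hh0 : ∀ x, h x ≠ 0 := by
    intro x hx
    have hx1 : x = χ x • q x := sub_eq_zero.1 hx
    have hx2 : ‖x‖ ≤ 1 := by
      rw [hx1, norm_smul, Real.norm_of_nonneg χ.nonneg]
      exact mul_le_one₀ χ.le_one (norm_nonneg _) (hb x)
    rw [χ.one_of_mem_closedBall (mem_closedBall_zero_iff.2 hx2), one_smul] at hx1
    exact hne x hx1.symm
  refine not_exists_contDiff_retraction (r := fun x => (2 / ‖h x‖) • h x) (R := 2) ?_ two_pos
    (fun x hx => ?_) fun x => ?_
  · exact (contDiff_const.div (hhd.norm ℝ hh0) fun x => norm_ne_zero_iff.2 (hh0 x)).smul hhd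
  · have : h x = x := by
      rw [hh]
      simp only
      rw [χ.zero_of_le_dist (by rw [dist_zero_right, hx]), zero_smul, sub_zero]
    simp only [this, hx]
    norm_num
  · have := norm_ne_zero_iff.2 (hh0 x)
    rw [norm_smul, norm_div, norm_norm, div_mul_cancel₀ _ this]
    norm_num

theorem exists_contDiff_approx {f : E → E} (hf : Continuous f) (hb : ∀ x, ‖f x‖ ≤ 1)
    {ε : ℝ} (hε : 0 < ε) :
    ∃ q : E → E, ContDiff ℝ 1 q ∧ (∀ x, ‖q x‖ ≤ 1) ∧ ∀ x, dist (q x) (f x) < ε := by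
  obtain ⟨q, hq⟩ := exists_contMDiffMap_forall_mem_convex_of_local_const (n := 1)
    (modelWithCornersSelf ℝ E) (F := E)
    (t := fun x => Metric.closedBall 0 1 ∩ Metric.ball (f x) ε)
    (fun x => (convex_closedBall _ _).inter (convex_ball _ _))
    (fun x => ⟨f x, by
      filter_upwards [hf.continuousAt.eventually (Metric.ball_mem_nhds (f x) hε)] with y hy
      exact ⟨mem_closedBall_zero_iff.2 (hb x), Metric.mem_ball_comm.1 hy⟩⟩)
  exact ⟨q, contMDiff_iff_contDiff.1 q.contMDiff, fun x => mem_closedBall_zero_iff.1 (hq x).1,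
    fun x => (hq x).2⟩

/-- Brouwer's fixed point theorem, for continuous maps of the whole space into its unit ball. A
continuous map without fixed points moves the points of the unit ball by at least some `ε > 0`, and
then so close a `C¹` approximation has no fixed point either. -/
theorem exists_fixedPoint_of_norm_le_one {f : E → E} (hf : Continuous f)
    (hb : ∀ x, ‖f x‖ ≤ 1) : ∃ x, f x = x := by
  by_contra! hne
  obtain ⟨x₀, -, hx₀⟩ := (isCompact_closedBall (0 : E) 1).exists_isMinOn
    ⟨0, Metric.mem_closedBall_self zero_le_one⟩ (f := fun x => dist x (f x))
    (by fun_prop)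
  obtain ⟨q, hq, hqb, hqf⟩ := exists_contDiff_approx hf hb (dist_pos.2 (hne x₀).symm)
  obtain ⟨x, hx⟩ := exists_fixedPoint_of_contDiff hq hqb
  have h1 := hx₀ (mem_closedBall_zero_iff.2 (hx ▸ hqb x) : x ∈ Metric.closedBall (0 : E) 1)
  have h2 := hqf x
  rw [hx] at h2
  exact absurd h2 (not_lt.2 h1)

end Brouwer

/-! ### Schauder's fixed point theorem -/

section Simplex

variable {ι : Type*} [Fintype ι]

/-- An explicit retraction of `ι → ℝ` onto the standard simplex: negative coordinates are set to
zero; if the sum `S` of the remaining ones is less than `1`, the deficit is spread evenly over all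
coordinates, and otherwise the vector is divided by `S`. -/
noncomputable def simplexRetraction (w : ι → ℝ) (i : ι) : ℝ :=
  (max (w i) 0 + max (1 - ∑ j, max (w j) 0) 0 / Fintype.card ι) / max 1 (∑ j, max (w j) 0)

theorem continuous_simplexRetraction :
    Continuous (simplexRetraction : (ι → ℝ) → ι → ℝ) := by
  unfold simplexRetraction
  refine continuous_pi fun i => Continuous.div (by fun_prop) (by fun_prop) fun w => ?_
  exact (lt_max_of_lt_left one_pos).ne'

theorem simplexRetraction_mem [Nonempty ι] (w : ι → ℝ) :
    simplexRetraction w ∈ stdSimplex ℝ ι := by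
  refine ⟨fun i => by unfold simplexRetraction; positivity, ?_⟩
  unfold simplexRetraction
  rw [← Finset.sum_div, Finset.sum_add_distrib, Finset.sum_const, Finset.card_univ, nsmul_eq_mul,
    mul_div_cancel₀ _ (by exact_mod_cast Fintype.card_ne_zero),
    div_eq_one_iff_eq (lt_max_of_lt_left one_pos).ne']
  rcases le_total 1 (∑ j, max (w j) 0) with h | h
  · rw [max_eq_right (by linarith), max_eq_right h, add_zero]
  · rw [max_eq_left (by linarith), max_eq_left h]
    ring

theorem simplexRetraction_of_mem {w : ι → ℝ} (hw : w ∈ stdSimplex ℝ ι) :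
    simplexRetraction w = w := by
  funext i
  have h : ∀ j, max (w j) 0 = w j := fun j => max_eq_left (hw.1 j)
  simp [simplexRetraction, h, hw.2]

theorem norm_toLp_le_one_of_mem_stdSimplex {w : ι → ℝ} (hw : w ∈ stdSimplex ℝ ι) :
    ‖(WithLp.toLp 2 w : EuclideanSpace ℝ ι)‖ ≤ 1 := by
  rw [EuclideanSpace.norm_eq, Real.sqrt_le_one, ← hw.2]
  refine Finset.sum_le_sum fun i _ => ?_
  have h0 := hw.1 i
  have h1 : w i ≤ 1 := hw.2 ▸ Finset.single_le_sum (fun j _ => hw.1 j) (Finset.mem_univ i)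
  simp only [Real.norm_eq_abs, sq_abs]
  nlinarith

theorem exists_fixedPoint_stdSimplex [Nonempty ι] {φ : (ι → ℝ) → ι → ℝ}
    (hφ : ContinuousOn φ (stdSimplex ℝ ι)) (hmaps : MapsTo φ (stdSimplex ℝ ι) (stdSimplex ℝ ι)) :
    ∃ w ∈ stdSimplex ℝ ι, φ w = w := by
  have hc : Continuous fun w : ι → ℝ => φ (simplexRetraction w) :=
    hφ.comp_continuous continuous_simplexRetraction simplexRetraction_mem
  obtain ⟨w, hw⟩ := exists_fixedPoint_of_norm_le_one
    (f := fun w : EuclideanSpace ℝ ι => WithLp.toLp 2 (φ (simplexRetraction (WithLp.ofLp w))))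
    ((PiLp.continuous_toLp 2 _).comp (hc.comp (PiLp.continuous_ofLp 2 _)))
    fun w => norm_toLp_le_one_of_mem_stdSimplex (hmaps (simplexRetraction_mem _))
  have hw' : φ (simplexRetraction (WithLp.ofLp w)) = WithLp.ofLp w := congrArg WithLp.ofLp hw
  have hmem : WithLp.ofLp w ∈ stdSimplex ℝ ι := hw' ▸ hmaps (simplexRetraction_mem _)
  exact ⟨WithLp.ofLp w, hmem, by rwa [simplexRetraction_of_mem hmem] at hw'⟩

end Simplex

section Schauder

variable {V : Type*} [NormedAddCommGroup V] [NormedSpace ℝ V]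

/-- Approximate fixed points. With a finite `ε`-net of `g(C)` inside `g(C)`, Brouwer's theorem applies
to the barycentric coordinates with respect to the net: `w` is sent to the normalized weights
`max (ε - dist (g x) i) 0`, where `x = ∑ wᵢ i`. At a fixed point `x` is a convex combination of
points of the net at distance less than `ε` from `g x`. -/
theorem exists_dist_le_of_totallyBounded {C : Set V} (hC : Convex ℝ C) (hne : C.Nonempty)
    {g : V → V} (hg : ContinuousOn g C) (hmaps : MapsTo g C C) (htb : TotallyBounded (g '' C))
    {ε : ℝ} (hε : 0 < ε) : ∃ x ∈ C, dist (g x) x ≤ ε := by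
  obtain ⟨t, htC, htfin, hcover⟩ := totallyBounded_iff_subset.1 htb _
    (Metric.dist_mem_uniformity hε)
  have hcov : ∀ x ∈ C, ∃ y ∈ t, dist (g x) y < ε := fun x hx => by
    simpa using hcover (mem_image_of_mem g hx)
  have : Fintype t := htfin.fintype
  have : Nonempty t := by
    obtain ⟨x, hx⟩ := hne
    obtain ⟨y, hy, -⟩ := hcov x hx
    exact ⟨⟨y, hy⟩⟩
  have htC' : ∀ i : t, (i : V) ∈ C := fun i => by
    obtain ⟨x, hx, hxi⟩ := htC i.2
    exact hxi ▸ hmaps hx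
  let μ : V → t → ℝ := fun x i => max (ε - dist (g x) i) 0
  have hμ0 : ∀ x i, 0 ≤ μ x i := fun x i => le_max_right _ _
  have hμpos : ∀ x ∈ C, 0 < ∑ i, μ x i := fun x hx => by
    obtain ⟨y, hy, hxy⟩ := hcov x hx
    exact Finset.sum_pos' (fun i _ => hμ0 x i)
      ⟨⟨y, hy⟩, Finset.mem_univ _, lt_max_of_lt_left (sub_pos.2 hxy)⟩
  have hμc : ∀ i, ContinuousOn (fun x => μ x i) C := fun i => by
    simp only [μ]
    fun_prop
  let comb : (t → ℝ) → V := fun w => ∑ i, w i • (i : V)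
  have hcomb : MapsTo comb (stdSimplex ℝ t) C := fun w hw =>
    hC.sum_mem (fun i _ => hw.1 i) hw.2 fun i _ => htC' i
  have hcombc : Continuous comb := by
    simp only [comb]
    fun_prop
  have hc : ContinuousOn (fun x => fun i => μ x i / ∑ j, μ x j) C :=
    continuousOn_pi.2 fun i => (hμc i).div (continuousOn_finsetSum _ fun j _ => hμc j)
      fun x hx => (hμpos x hx).ne'
  obtain ⟨w, hw, hfix⟩ := exists_fixedPoint_stdSimplex
    (φ := fun w i => μ (comb w) i / ∑ j, μ (comb w) j)
    (hc.comp hcombc.continuousOn hcomb) (fun w hw => ⟨fun i => div_nonneg (hμ0 _ _)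
      (hμpos _ (hcomb hw)).le, by rw [← Finset.sum_div, div_self (hμpos _ (hcomb hw)).ne']⟩)
  refine ⟨comb w, hcomb hw, ?_⟩
  have h1 : g (comb w) - comb w = ∑ i, w i • (g (comb w) - (i : V)) := by
    simp only [smul_sub, Finset.sum_sub_distrib, ← Finset.sum_smul, hw.2, one_smul, comb]
  rw [dist_eq_norm, h1]
  calc ‖∑ i, w i • (g (comb w) - (i : V))‖ ≤ ∑ i, ‖w i • (g (comb w) - (i : V))‖ := norm_sum_le _ _
    _ ≤ ∑ i, w i * ε := by
        refine Finset.sum_le_sum fun i _ => ?_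
        rw [norm_smul, Real.norm_of_nonneg (hw.1 i), ← dist_eq_norm]
        rcases le_or_gt (dist (g (comb w)) (i : V)) ε with h | h
        · exact mul_le_mul_of_nonneg_left h (hw.1 i)
        -- points of the net farther than `ε` from `g x` carry no weight
        · have h2 : w i = 0 := by
            rw [← congrFun hfix i]
            simp only [μ]
            rw [max_eq_right (by linarith), zero_div]
          simp [h2]
    _ = ε := by rw [← Finset.sum_mul, hw.2, one_mul]

/-- Schauder's fixed point theorem. -/
theorem exists_fixedPoint_of_isCompact_closure_image {C : Set V} (hC : Convex ℝ C)
    (hclosed : IsClosed C) (hne : C.Nonempty) {g : V → V} (hg : ContinuousOn g C)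
    (hmaps : MapsTo g C C) (hK : IsCompact (closure (g '' C))) : ∃ x ∈ C, g x = x := by
  have htb : TotallyBounded (g '' C) := hK.totallyBounded.subset subset_closure
  choose x hxC hx using fun n : ℕ =>
    exists_dist_le_of_totallyBounded hC hne hg hmaps htb (Nat.one_div_pos_of_nat (n := n) (α := ℝ))
  obtain ⟨y, hy, φ, hφ, hlim⟩ :=
    hK.tendsto_subseq fun n => subset_closure (mem_image_of_mem g (hxC n))
  have hyC : y ∈ C := closure_minimal hmaps.image_subset hclosed hy
  have hdist : Filter.Tendsto (fun n => dist (g (x (φ n))) (x (φ n))) Filter.atTop (nhds 0) :=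
    squeeze_zero (fun _ => dist_nonneg) (fun n => hx (φ n))
      (tendsto_one_div_add_atTop_nhds_zero_nat.comp hφ.tendsto_atTop)
  have hxlim : Filter.Tendsto (fun n => x (φ n)) Filter.atTop (nhds y) :=
    (tendsto_iff_of_dist hdist).1 hlim
  refine ⟨y, hyC, tendsto_nhds_unique ?_ hlim⟩
  exact (hg y hyC).tendsto.comp (tendsto_nhdsWithin_iff.2
    ⟨hxlim, Filter.Eventually.of_forall fun n => hxC _⟩)

/-- A form of the Birkhoff–Kellogg theorem on invariant directions: a compact map on a ball whose
values stay away from zero has a positive eigenvalue with an eigenvector on the bounding sphere.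
Since `T` is defined on the whole ball, this is Schauder's theorem for `u ↦ (ρ / ‖T u‖) • T u`. -/
theorem exists_pos_smul_eq_of_norm_ge {T : V → V} {ρ δ : ℝ} (hρ : 0 < ρ) (hδ : 0 < δ)
    (hT : ContinuousOn T (Metric.closedBall 0 ρ)) {K : Set V} (hK : IsCompact K)
    (hmaps : MapsTo T (Metric.closedBall 0 ρ) K)
    (hbd : ∀ u ∈ Metric.closedBall 0 ρ, δ ≤ ‖T u‖) :
    ∃ l : ℝ, 0 < l ∧ ∃ u, ‖u‖ = ρ ∧ u = l • T u := by
  let N : V → V := fun w => (ρ / ‖w‖) • w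
  set S : Set V := {w | δ ≤ ‖w‖} with hS
  have hSclosed : IsClosed S := isClosed_le continuous_const continuous_norm
  have hN : ContinuousOn N S := ContinuousOn.smul
    (continuousOn_const.div continuous_norm.continuousOn fun w hw => (hδ.trans_le hw).ne')
    continuousOn_id
  have hnorm : ∀ w ∈ S, ‖N w‖ = ρ := fun w hw => by
    have : ‖w‖ ≠ 0 := (hδ.trans_le hw).ne'
    rw [norm_smul, norm_div, norm_norm, Real.norm_of_nonneg hρ.le, div_mul_cancel₀ _ this]
  have hcomp : IsCompact (N '' (K ∩ S)) :=
    (hK.inter_right hSclosed).image_of_continuousOn (hN.mono inter_subset_right)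
  obtain ⟨u, hu, hfix⟩ := exists_fixedPoint_of_isCompact_closure_image
    (convex_closedBall (0 : V) ρ) Metric.isClosed_closedBall
    ⟨0, Metric.mem_closedBall_self hρ.le⟩ (g := fun u => N (T u)) (hN.comp hT hbd)
    (fun u hu => mem_closedBall_zero_iff.2 (hnorm _ (hbd u hu)).le)
    (hcomp.closure_of_subset (by
      rintro _ ⟨u, hu, rfl⟩
      exact mem_image_of_mem N ⟨hmaps hu, hbd u hu⟩))
  refine ⟨ρ / ‖T u‖, div_pos hρ (hδ.trans_le (hbd u hu)), u, ?_, hfix.symm⟩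
  rw [← hfix]
  exact hnorm _ (hbd u hu)

end Schauder

/-! ### The Hammerstein integral operator -/

theorem norm_integral_unitInterval_le (φ : C(I, ℝ)) : ‖∫ s : I, φ s‖ ≤ ‖φ‖ := by
  simpa using norm_integral_le_of_norm_le_const (μ := (volume : Measure I))
    (Filter.Eventually.of_forall φ.norm_coe_le_norm)

theorem integrable_unitInterval (φ : C(I, ℝ)) : Integrable (fun s : I => φ s) :=
  φ.continuous.integrable_of_hasCompactSupport (HasCompactSupport.of_compactSpace _)

theorem lipschitzWith_integral_unitInterval :
    LipschitzWith 1 fun φ : C(I, ℝ) => ∫ s : I, φ s :=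
  LipschitzWith.of_dist_le_mul fun φ ψ => by
    rw [dist_eq_norm, dist_eq_norm, NNReal.coe_one, one_mul,
      ← integral_sub (integrable_unitInterval φ) (integrable_unitInterval ψ)]
    exact norm_integral_unitInterval_le (φ - ψ)

theorem continuous_integral_curry_mul (k : C(I × I, ℝ)) :
    Continuous fun p : C(I, ℝ) × I => ∫ s : I, (k.curry p.2 * p.1) s :=
  lipschitzWith_integral_unitInterval.continuous.comp
    ((k.curry.continuous.comp continuous_snd).mul continuous_fst)

/-- The linear integral operator with continuous kernel `k`, as a map of `C([0,1])` to itself. -/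
noncomputable def kernelOperator (k : C(I × I, ℝ)) (g : C(I, ℝ)) : C(I, ℝ) where
  toFun t := ∫ s : I, k (t, s) * g s
  continuous_toFun := (continuous_integral_curry_mul k).comp (Continuous.prodMk_right g)

theorem continuous_kernelOperator (k : C(I × I, ℝ)) : Continuous (kernelOperator k) :=
  ContinuousMap.continuous_of_continuous_uncurry _ (continuous_integral_curry_mul k)

/-- The integral operator is compact, by Arzelà–Ascoli. -/
theorem isCompact_closure_kernelOperator_image (k : C(I × I, ℝ)) (B : ℝ) :
    IsCompact (closure (kernelOperator k '' Metric.closedBall 0 B)) := by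
  let e := ContinuousMap.isometryEquivBoundedOfCompact I ℝ
  rw [← e.toHomeomorph.isCompact_image, e.toHomeomorph.image_closure]
  refine BoundedContinuousFunction.arzela_ascoli (Metric.closedBall 0 (‖k‖ * B))
    (isCompact_closedBall _ _) _ ?_ ?_
  · rintro _ t ⟨_, ⟨g, hg, rfl⟩, rfl⟩
    rw [mem_closedBall_zero_iff] at hg ⊢
    refine (norm_integral_unitInterval_le (k.curry t * g)).trans ((norm_mul_le _ _).trans ?_)
    gcongr
    exact (ContinuousMap.norm_le _ (norm_nonneg _)).2 fun s => k.norm_coe_le_norm (t, s)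
  · intro t₀
    rw [Metric.equicontinuousAt_iff]
    intro ε hε
    have hB : 0 < |B| + 1 := by positivity
    obtain ⟨δ, hδ, h⟩ := Metric.continuousAt_iff.1 (k.curry.continuous.continuousAt (x := t₀))
      (ε / (|B| + 1)) (div_pos hε hB)
    refine ⟨δ, hδ, fun t ht => ?_⟩
    rintro ⟨_, _, ⟨g, hg, rfl⟩, rfl⟩
    rw [mem_closedBall_zero_iff] at hg
    change dist (∫ s, (k.curry t₀ * g) s) (∫ s, (k.curry t * g) s) < ε
    calc dist (∫ s, (k.curry t₀ * g) s) (∫ s, (k.curry t * g) s)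
        ≤ dist (k.curry t₀ * g) (k.curry t * g) := by
          simpa using lipschitzWith_integral_unitInterval.dist_le_mul (k.curry t₀ * g)
            (k.curry t * g)
      _ ≤ dist (k.curry t) (k.curry t₀) * (|B| + 1) := by
          rw [dist_comm, dist_eq_norm, dist_eq_norm, ← sub_mul]
          refine (norm_mul_le _ _).trans ?_
          gcongr
          exact hg.trans ((le_abs_self B).trans (by linarith))
      _ < ε := (lt_div_iff₀ hB).1 (h ht)

theorem kernelOperator_mono {k : C(I × I, ℝ)} (hk : ∀ p, 0 ≤ k p) {g h : C(I, ℝ)}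
    (hgh : ∀ s, g s ≤ h s) (t : I) : kernelOperator k g t ≤ kernelOperator k h t :=
  integral_mono (integrable_unitInterval (k.curry t * g)) (integrable_unitInterval (k.curry t * h))
    fun s => mul_le_mul_of_nonneg_left (hgh s) (hk (t, s))

/-- The superposition operator `(u, v) ↦ f(·, u(·), v)`, for `v` a real parameter. -/
def superposition (f : C(I × ℝ × ℝ, ℝ)) (p : C(I, ℝ) × ℝ) : C(I, ℝ) where
  toFun s := f (s, p.1 s, p.2)

theorem continuous_superposition (f : C(I × ℝ × ℝ, ℝ)) : Continuous (superposition f) :=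
  ContinuousMap.continuous_of_continuous_uncurry _
    (f.continuous.comp (by fun_prop : Continuous fun q : (C(I, ℝ) × ℝ) × I =>
      (q.2, q.1.1 q.2, q.1.2)))

/-- Clamping the second and third variables to their intervals extends `f` continuously to the whole
space and keeps the pointwise bounds. -/
theorem exists_continuousMap_extension {f : I × ℝ × ℝ → ℝ} {a b c d : ℝ} (hab : a ≤ b)
    (hcd : c ≤ d) (hf : ContinuousOn f (univ ×ˢ Icc a b ×ˢ Icc c d)) {flo fhi : I → ℝ}
    (hfb : ∀ t : I, ∀ x ∈ Icc a b, ∀ v ∈ Icc c d, flo t ≤ f (t, x, v) ∧ f (t, x, v) ≤ fhi t) :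
    ∃ F : C(I × ℝ × ℝ, ℝ), (∀ p ∈ univ ×ˢ Icc a b ×ˢ Icc c d, F p = f p) ∧
      ∀ t x v, flo t ≤ F (t, x, v) ∧ F (t, x, v) ≤ fhi t := by
  refine ⟨⟨fun p => f (p.1, projIcc a b hab p.2.1, projIcc c d hcd p.2.2),
    hf.comp_continuous (by fun_prop) fun p => ⟨mem_univ _, Subtype.prop _, Subtype.prop _⟩⟩,
    ?_, fun t x v => hfb t _ (Subtype.prop _) _ (Subtype.prop _)⟩
  rintro ⟨t, x, v⟩ ⟨-, hx, hv⟩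
  simp only [ContinuousMap.coe_mk]
  rw [projIcc_of_mem hab hx, projIcc_of_mem hcd hv]

/-! ### Existence of eigenvalues of both signs and their bounds -/

theorem theorem2 (ρ : ℝ) (hρ : 0 < ρ)
    (k : I × I → ℝ) (hk : Continuous k) (hk0 : ∀ p, 0 ≤ k p)
    (H : C(I, ℝ) → ℝ) (hH : ContinuousOn H (Metric.closedBall 0 ρ))
    (Hlo Hhi : ℝ) (hHb : ∀ u ∈ Metric.closedBall (0 : C(I, ℝ)) ρ, Hlo ≤ H u ∧ H u ≤ Hhi)
    (f : I × ℝ × ℝ → ℝ)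
    (hf : ContinuousOn f (univ ×ˢ Icc (-ρ) ρ ×ˢ Icc Hlo Hhi))
    (flo fhi : I → ℝ) (hflo : Continuous flo) (hfhi : Continuous fhi)
    (hfb : ∀ t : I, ∀ x ∈ Icc (-ρ) ρ, ∀ v ∈ Icc Hlo Hhi,
      flo t ≤ f (t, x, v) ∧ f (t, x, v) ≤ fhi t)
    (h5 : (∃ t : I, kernelIntegral k fhi t < 0) ∨ (∃ t : I, 0 < kernelIntegral k flo t)) :
    (∃ l : ℝ, 0 < l ∧ ∃ u : C(I, ℝ), ‖u‖ = ρ ∧ SolvesHammerstein k f H l u) ∧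
    (∃ l : ℝ, l < 0 ∧ ∃ u : C(I, ℝ), ‖u‖ = ρ ∧ SolvesHammerstein k f H l u) ∧
    (∀ (l : ℝ) (u : C(I, ℝ)), ‖u‖ = ρ → SolvesHammerstein k f H l u →
      (∀ t : I, kernelIntegral k fhi t < 0 → |l| ≤ -(ρ / kernelIntegral k fhi t)) ∧
      (∀ t : I, 0 < kernelIntegral k flo t → |l| ≤ ρ / kernelIntegral k flo t)) := by
  have h0 := hHb 0 (Metric.mem_closedBall_self hρ.le)
  obtain ⟨F, hFf, hFb⟩ := exists_continuousMap_extension (by linarith : -ρ ≤ ρ)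
    (h0.1.trans h0.2) hf hfb
  let K : C(I × I, ℝ) := ⟨k, hk⟩
  let glo : C(I, ℝ) := ⟨flo, hflo⟩
  let ghi : C(I, ℝ) := ⟨fhi, hfhi⟩
  let T : C(I, ℝ) → C(I, ℝ) := fun u => kernelOperator K (superposition F (u, H u))
  have hTval : ∀ u ∈ Metric.closedBall (0 : C(I, ℝ)) ρ, ∀ t,
      T u t = ∫ s : I, k (t, s) * f (s, u s, H u) := fun u hu t => by
    refine integral_congr_ae (Filter.Eventually.of_forall fun s => ?_)
    have hus : u s ∈ Icc (-ρ) ρ := abs_le.1 ((u.norm_coe_le_norm s).trans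
      (mem_closedBall_zero_iff.1 hu))
    exact congrArg (k (t, s) * ·) (hFf (s, u s, H u) ⟨mem_univ _, hus, hHb u hu⟩)
  have hThi : ∀ u t, T u t ≤ kernelIntegral k fhi t := fun u t =>
    kernelOperator_mono (k := K) (h := ghi) hk0 (fun s => (hFb s _ _).2) t
  have hTlo : ∀ u t, kernelIntegral k flo t ≤ T u t := fun u t =>
    kernelOperator_mono (k := K) (g := glo) hk0 (fun s => (hFb s _ _).1) t
  have hTcont : ContinuousOn T (Metric.closedBall 0 ρ) :=
    ((continuous_kernelOperator K).comp (continuous_superposition F)).comp_continuousOn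
      (continuousOn_id.prodMk hH)
  have hball : ∀ p, superposition F p ∈ Metric.closedBall 0 (max ‖glo‖ ‖ghi‖) := fun p => by
    refine mem_closedBall_zero_iff.2 ((ContinuousMap.norm_le _ (by positivity)).2 fun s => ?_)
    refine abs_le_max_abs_abs (hFb s _ _).1 (hFb s _ _).2 |>.trans ?_
    exact max_le_max (glo.norm_coe_le_norm s) (ghi.norm_coe_le_norm s)
  set S := closure (kernelOperator K '' Metric.closedBall 0 (max ‖glo‖ ‖ghi‖)) with hSdef
  have hS : IsCompact S := isCompact_closure_kernelOperator_image K _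
  have hTS : ∀ u, T u ∈ S := fun u => subset_closure (mem_image_of_mem _ (hball _))
  -- At the distinguished point `t`, all values `T u t` have the same sign and are bounded away
  -- from `0`.
  obtain ⟨δ, hδ, hTδ⟩ : ∃ δ > 0, ∀ u, δ ≤ ‖T u‖ := by
    rcases h5 with ⟨t, ht⟩ | ⟨t, ht⟩
    · exact ⟨_, neg_pos.2 ht, fun u => (neg_le_neg (hThi u t)).trans
        ((neg_le_abs _).trans ((T u).norm_coe_le_norm t))⟩
    · exact ⟨_, ht, fun u => (hTlo u t).trans
        ((le_abs_self _).trans ((T u).norm_coe_le_norm t))⟩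
  have hsol : ∀ l u, ‖u‖ = ρ → u = l • T u → SolvesHammerstein k f H l u := fun l u hu h t => by
    rw [← hTval u (mem_closedBall_zero_iff.2 hu.le) t]
    exact DFunLike.congr_fun h t
  refine ⟨?_, ?_, fun l u hu hs => ?_⟩
  · obtain ⟨l, hl, u, hu, h⟩ := exists_pos_smul_eq_of_norm_ge hρ hδ hTcont hS (fun u _ => hTS u)
      fun u _ => hTδ u
    exact ⟨l, hl, u, hu, hsol l u hu h⟩
  · obtain ⟨l, hl, u, hu, h⟩ := exists_pos_smul_eq_of_norm_ge (T := fun u => -T u) hρ hδ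
      hTcont.neg hS.neg (fun u _ => Set.neg_mem_neg.2 (hTS u))
      fun u _ => (norm_neg (T u)).symm ▸ hTδ u
    exact ⟨-l, neg_neg_of_pos hl, u, hu, hsol (-l) u hu (by rw [neg_smul, ← smul_neg]; exact h)⟩
  · have hle : ∀ t, |l| * |T u t| ≤ ρ := fun t => by
      rw [← abs_mul, hTval u (mem_closedBall_zero_iff.2 hu.le) t, ← hs t, ← hu]
      exact u.norm_coe_le_norm t
    constructor <;> intro t ht
    · rw [← div_neg, le_div_iff₀ (neg_pos.2 ht)]
      exact (mul_le_mul_of_nonneg_left ((neg_le_neg (hThi u t)).trans (neg_le_abs _))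
        (abs_nonneg l)).trans (hle t)
    · rw [le_div_iff₀ ht]
      exact (mul_le_mul_of_nonneg_left ((hTlo u t).trans (le_abs_self _))
        (abs_nonneg l)).trans (hle t)
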